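/- Let $\mathfrak g$ be a finite-dimensional real Lie algebra which is solvable and unimodular (i.e. $\operatorname{tr}(\operatorname{ad}_x)=0$ for all $x\in\mathfrak g$), and suppose that its nilradical $\mathfrak h$ (the largest nilpotent ideal of $\mathfrak g$) has codimension $2$. Let $J$ be a complex structure on $\mathfrak g$, i.e. an endomorphism with $J^2=-\mathrm{id}$ and $[Jx,Jy]-[x,y]-J[Jx,y]-J[x,Jy]=0$ for all $x,y\in\mathfrak g$, and suppose that $J\mathfrak h=\mathfrak h$. A $J$-Hermitian metric on $\mathfrak g$ is a positive definite inner product $\langle\cdot,\cdot\rangle$ with $\langle Jx,Jy\rangle=\langle x,y\rangle$; its fundamental form is $\omega=\langle J\cdot,\cdot\rangle$. Let $d$ be the Chevalley–Eilenberg differential of $\mathfrak g$. The metric is called Kähler if $d\omega=0$; SKT if the $3$-form $c(x,y,z)=d\omega(Jx,Jy,Jz)$ satisfies $dc=0$; and balanced if $\omega$ is co-closed, $d^*\omega=0$, where $d^*\omega=-\sum_i\iota_{e_i}\nabla_{e_i}\omega$ for $\nabla$ the Levi-Civita connection of the metric on $\mathfrak g$ and $(e_i)$ an orthonormal basis (equivalently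 $d\omega^{n-1}=0$, $2n=\dim\mathfrak g$). Suppose that $\mathfrak g$ admits a $J$-Hermitian SKT metric $\langle\cdot,\cdot\rangle_1$ and a $J$-Hermitian balanced metric $\langle\cdot,\cdot\rangle_2$ such that the orthogonal complement of $\mathfrak h$ with respect to $\langle\cdot,\cdot\rangle_2$ is abelian: $[\mathfrak h^{\perp_{\langle\cdot,\cdot\rangle_2}},\mathfrak h^{\perp_{\langle\cdot,\cdot\rangle_2}}]=0$. Then $\mathfrak g$ admits a $J$-Hermitian Kähler metric. -/

import Mathlib

namespace HermitianLie

/-- `h` is the nilradical of `𝔤`: the largest ideal which is nilpotent as a Lie algebra.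
(Mathlib's `LieAlgebra.maxNilpotentIdeal` is a different object: it is the largest ideal which is
nilpotent as a module over the whole Lie algebra.) -/
def IsNilradical {𝔤 : Type*} [LieRing 𝔤] [LieAlgebra ℝ 𝔤] (h : LieIdeal ℝ 𝔤) : Prop :=
  IsGreatest {I : LieIdeal ℝ 𝔤 | LieRing.IsNilpotent I} h

/-- A Lie algebra is unimodular if `tr (ad x) = 0` for all `x`. -/
def IsUnimodular (𝔤 : Type*) [LieRing 𝔤] [LieAlgebra ℝ 𝔤] : Prop :=
  ∀ x : 𝔤, LinearMap.trace ℝ 𝔤 (LieAlgebra.ad ℝ 𝔤 x) = 0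

/-- A complex structure on a real Lie algebra: an endomorphism `J` with `J² = -1` whose Nijenhuis
tensor vanishes. -/
structure ComplexStructure (𝔤 : Type*) [LieRing 𝔤] [LieAlgebra ℝ 𝔤] where
  J : 𝔤 →ₗ[ℝ] 𝔤
  J_sq : ∀ x, J (J x) = -x
  nijenhuis : ∀ x y, ⁅J x, J y⁆ - ⁅x, y⁆ - J ⁅J x, y⁆ - J ⁅x, J y⁆ = 0

/-- The Chevalley–Eilenberg differential of a 2-form on a Lie algebra (the exterior derivative of
the corresponding left invariant form). -/
def d₂ {𝔤 : Type*} [LieRing 𝔤] (α : 𝔤 → 𝔤 → ℝ) (x y z : 𝔤) : ℝ :=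
  -α ⁅x, y⁆ z + α ⁅x, z⁆ y - α ⁅y, z⁆ x

/-- The Chevalley–Eilenberg differential of a 3-form on a Lie algebra. -/
def d₃ {𝔤 : Type*} [LieRing 𝔤] (c : 𝔤 → 𝔤 → 𝔤 → ℝ) (w x y z : 𝔤) : ℝ :=
  -c ⁅w, x⁆ y z + c ⁅w, y⁆ x z - c ⁅w, z⁆ x y - c ⁅x, y⁆ w z + c ⁅x, z⁆ w y - c ⁅y, z⁆ w x

/-- A `J`-Hermitian metric on a Lie algebra with complex structure: a `J`-invariant inner product. -/
structure HermitianMetric {𝔤 : Type*} [LieRing 𝔤] [LieAlgebra ℝ 𝔤] (C : ComplexStructure 𝔤) where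
  inner : LinearMap.BilinForm ℝ 𝔤
  symm : ∀ x y, inner x y = inner y x
  pos : ∀ x, x ≠ 0 → 0 < inner x x
  invariant : ∀ x y, inner (C.J x) (C.J y) = inner x y

namespace HermitianMetric

variable {𝔤 : Type*} [LieRing 𝔤] [LieAlgebra ℝ 𝔤] {C : ComplexStructure 𝔤}

/-- The fundamental form `ω(x, y) = ⟨J x, y⟩`. -/
def fundamentalForm (g : HermitianMetric C) (x y : 𝔤) : ℝ :=
  g.inner (C.J x) y

/-- Kähler: `dω = 0` (the complex structure is integrable by definition). -/
def IsKahler (g : HermitianMetric C) : Prop :=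
  ∀ x y z, d₂ g.fundamentalForm x y z = 0

/-- The torsion 3-form of the Bismut connection, `c(x, y, z) = dω(J x, J y, J z)`. -/
def bismutTorsion (g : HermitianMetric C) (x y z : 𝔤) : ℝ :=
  d₂ g.fundamentalForm (C.J x) (C.J y) (C.J z)

/-- SKT (pluriclosed): the Bismut torsion 3-form is closed. -/
def IsSKT (g : HermitianMetric C) : Prop :=
  ∀ w x y z, d₃ g.bismutTorsion w x y z = 0

theorem nondegenerate (g : HermitianMetric C) : g.inner.Nondegenerate := by
  refine ⟨fun x hx => ?_, fun x hx => ?_⟩ <;>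
  · by_contra h
    exact (g.pos x h).ne' (hx x)

/-- The linear form `z ↦ ⟨[x,y],z⟩ - ⟨[y,z],x⟩ + ⟨[z,x],y⟩`, which is `z ↦ 2⟨∇_x y, z⟩` for the
Levi-Civita connection `∇` of the left invariant metric (Koszul formula). -/
def koszul (g : HermitianMetric C) (x y : 𝔤) : Module.Dual ℝ 𝔤 where
  toFun z := g.inner ⁅x, y⁆ z - g.inner ⁅y, z⁆ x + g.inner ⁅z, x⁆ y
  map_add' a b := by simp; ring
  map_smul' r a := by simp; ring

variable [FiniteDimensional ℝ 𝔤]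

/-- The Levi-Civita connection `∇_x y` of the metric. -/
noncomputable def leviCivita (g : HermitianMetric C) (x y : 𝔤) : 𝔤 :=
  (g.inner.toDual g.nondegenerate).symm ((1 / 2 : ℝ) • g.koszul x y)

/-- The covariant derivative `(∇_x α)(y, z)` of a 2-form `α` on the Lie algebra. -/
noncomputable def covDeriv (g : HermitianMetric C) (α : 𝔤 → 𝔤 → ℝ) (x y z : 𝔤) : ℝ :=
  -α (g.leviCivita x y) z - α y (g.leviCivita x z)

/-- The codifferential `d^*α = -∑ᵢ ι_{eᵢ} ∇_{eᵢ} α` of a 2-form, written in a basis `e`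
(to be taken orthonormal; the value does not depend on which orthonormal basis is taken). -/
noncomputable def codifferential (g : HermitianMetric C) {ι : Type*} [Fintype ι]
    (e : Module.Basis ι ℝ 𝔤) (α : 𝔤 → 𝔤 → ℝ) (x : 𝔤) : ℝ :=
  -∑ i, g.covDeriv α (e i) (e i) x

/-- Balanced: the fundamental form is co-closed, `d^*ω = 0`. -/
def IsBalanced (g : HermitianMetric C) : Prop :=
  ∀ e : Module.Basis (Fin (Module.finrank ℝ 𝔤)) ℝ 𝔤,
    (∀ i j, g.inner (e i) (e j) = if i = j then 1 else 0) →
      ∀ x, g.codifferential e g.fundamentalForm x = 0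

end HermitianMetric

end HermitianLie

/-!
Write `D = ad (Jz)`. The hypotheses force the nilradical `h` to be abelian, and on an abelian `h`
the SKT condition already contains the Kähler condition.

*The nilradical is abelian.* On a unimodular Lie algebra the codifferential of the fundamental form
is dual to `∑ [eᵢ, J eᵢ]`, for `e` orthonormal. Splitting `𝔤 = h ⊕ h^⊥` for the balanced metric, the
abelian summand `h^⊥` contributes nothing, so `∑ [eᵢ, J eᵢ] = 0` for a basis `e` of `h`
(`exists_basis_sum_lie_eq_zero`). On the nilpotent Lie algebra `h`, the restricted metric `g₁` is
SKT. For central `z`, evaluating `dc(z, Jz, y, Jy) = 0` along the lower central series shows that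
`Jz` is central (`lie_J_eq_zero_of_isSKT`). For `z` in the second centre the same identity says
that, modulo the centre, the second derivative of `|exp (tD) y|²` plus some squares, `|[z, y]|²`
among them, is a linear function of `[y, Jy]`; the flow `exp (tD)` preserves brackets, so summing
over `y = eᵢ` cancels the linear term. A nonnegative function on the line with nonpositive second
derivative is constant, so all squares vanish and `z` is central
(`lie_eq_zero_of_lie_mem_center_of_perp`). The second centre being the centre, `h` is abelian
(`lie_eq_zero_of_isSKT_of_sum_lie_eq_zero`).

*The metric.* For `x` in `𝔤`, trace `dc(x, Jx, y, Jy) = 0` over an orthonormal basis of the abelian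
ideal `h`. By `tr (T²) - |T|² = -|T - Tᵗ|² / 2` this is the vanishing of a sum of squared norms of
skew parts, hence `J ∘ ad x` is `g₁`-symmetric on `h` (`inner_J_lie_symm_of_isSKT`). Any Hermitian
metric equal to `g₁` on `h`, with the abelian space `h^⊥` orthogonal to `h`, is then Kähler
(`isKahler_glue`).
-/

namespace HermitianLie

/-! ### Orthonormal bases and concave functions -/

/-- A symmetric positive definite bilinear form on a finite-dimensional real vector space has an
orthonormal basis. -/
theorem exists_orthonormal_basis {V : Type*} [AddCommGroup V] [Module ℝ V] [FiniteDimensional ℝ V]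
    (B : LinearMap.BilinForm ℝ V) (hs : ∀ x y, B x y = B y x) (hp : ∀ x, x ≠ 0 → 0 < B x x) :
    ∃ e : Module.Basis (Fin (Module.finrank ℝ V)) ℝ V,
      ∀ i j, B (e i) (e j) = if i = j then 1 else 0 := by
  let c : InnerProductSpace.Core ℝ V :=
    { inner := fun x y => B x y
      conj_inner_symm := fun x y => by simp [hs x y]
      re_inner_nonneg := fun x => by
        by_cases hx : x = 0
        · simp [hx]
        · simpa using (hp x hx).le
      add_left := fun x y z => by simp
      smul_left := fun x y r => by simp
      definite := fun x hx => by
        by_contra h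
        exact (hp x h).ne' hx }
  let _ : NormedAddCommGroup V := c.toNormedAddCommGroup
  let _ : InnerProductSpace ℝ V := InnerProductSpace.ofCore c.toCore
  refine ⟨(stdOrthonormalBasis ℝ V).toBasis, fun i j => ?_⟩
  have := orthonormal_iff_ite.mp (stdOrthonormalBasis ℝ V).orthonormal i j
  rw [OrthonormalBasis.coe_toBasis]
  exact this

/-- A twice differentiable function on the whole line which is nonnegative and concave is
constant; only the vanishing of its second derivative is recorded. -/
theorem second_deriv_eq_zero_of_nonneg_of_nonpos {f f' f'' : ℝ → ℝ}
    (h1 : ∀ t, HasDerivAt f (f' t) t) (h2 : ∀ t, HasDerivAt f' (f'' t) t)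
    (hf : ∀ t, 0 ≤ f t) (hc : ∀ t, f'' t ≤ 0) (t : ℝ) : f'' t = 0 := by
  have hanti : Antitone f' := antitone_of_hasDerivAt_nonpos h2 hc
  -- A concave function lies below each of its tangent lines.
  have htan : ∀ a s, f s ≤ f a + f' a * (s - a) := by
    intro a s
    have hconc : ConcaveOn ℝ Set.univ f := by
      refine AntitoneOn.concaveOn_of_deriv convex_univ
        (fun x _ => (h1 x).continuousAt.continuousWithinAt)
        (fun x _ => (h1 x).differentiableAt.differentiableWithinAt) ?_
      have : deriv f = f' := funext fun x => (h1 x).deriv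
      rw [this]
      exact hanti.antitoneOn _
    rcases lt_trichotomy a s with h | h | h
    · have := hconc.slope_le_of_hasDerivAt (Set.mem_univ a) (Set.mem_univ s) h (h1 a)
      rw [slope_def_field, div_le_iff₀ (by linarith)] at this
      linarith
    · simp [h]
    · have := hconc.le_slope_of_hasDerivAt (Set.mem_univ s) (Set.mem_univ a) h (h1 a)
      rw [slope_def_field, le_div_iff₀ (by linarith)] at this
      linarith
  have hz : ∀ a, f' a = 0 := by
    intro a
    by_contra hne
    have h3 := htan a (a - (f a + 1) / f' a)
    have h4 := hf (a - (f a + 1) / f' a)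
    have h5 : f' a * (a - (f a + 1) / f' a - a) = -(f a + 1) := by field_simp; ring
    linarith
  have : f' = fun _ => 0 := funext hz
  have h6 := h2 t
  rw [this] at h6
  exact h6.unique (hasDerivAt_const t 0)

/-! ### Induction along the lower central series -/

/-- In a nilpotent Lie algebra, a property of elements which is implied by its validity on all
elements one step deeper in the lower central series holds everywhere. -/
theorem lowerCentralSeries_induction {L : Type*} [LieRing L] [LieAlgebra ℝ L]
    [LieRing.IsNilpotent L] {p : L → Prop} (h0 : p 0)
    (hstep : ∀ k, (∀ u ∈ LieModule.lowerCentralSeries ℝ L L (k + 1), p u) →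
      ∀ y ∈ LieModule.lowerCentralSeries ℝ L L k, p y) (y : L) : p y := by
  obtain ⟨n, hn⟩ := LieModule.IsNilpotent.nilpotent ℝ L L
  have key : ∀ m k, m + k = n → ∀ y ∈ LieModule.lowerCentralSeries ℝ L L k, p y := by
    intro m
    induction m with
    | zero =>
      intro k hk y hy
      rw [show k = n by omega, hn, LieSubmodule.mem_bot] at hy
      rwa [hy]
    | succ m ih =>
      intro k hk
      exact hstep k (ih (k + 1) (by omega))
  exact key n 0 (by omega) y (by simp)

theorem lie_mem_lowerCentralSeries_succ {L : Type*} [LieRing L] [LieAlgebra ℝ L] {k : ℕ} {y : L}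
    (x : L) (hy : y ∈ LieModule.lowerCentralSeries ℝ L L k) :
    ⁅x, y⁆ ∈ LieModule.lowerCentralSeries ℝ L L (k + 1) := by
  rw [LieModule.lowerCentralSeries_succ]
  exact LieSubmodule.lie_mem_lie (LieSubmodule.mem_top x) hy

/-! ### The flow of a nilpotent endomorphism -/

/-- The exponential `exp (t D)` of an endomorphism with `D ^ n = 0`, as a polynomial in `t`. -/
noncomputable def nilpotentFlow {V : Type*} [AddCommGroup V] [Module ℝ V] (D : Module.End ℝ V)
    (n : ℕ) (t : ℝ) : Module.End ℝ V :=
  ∑ i ∈ Finset.range n, (t ^ i / (i.factorial : ℝ)) • D ^ i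

section Flow

variable {V : Type*} [AddCommGroup V] [Module ℝ V] {D : Module.End ℝ V} {n : ℕ}

theorem nilpotentFlow_apply (t : ℝ) (v : V) :
    nilpotentFlow D n t v = ∑ i ∈ Finset.range n, (t ^ i / (i.factorial : ℝ)) • (D ^ i) v := by
  simp [nilpotentFlow, LinearMap.sum_apply]

theorem nilpotentFlow_zero (hD : D ^ n = 0) : nilpotentFlow D n 0 = 1 := by
  cases n with
  | zero =>
    rw [pow_zero] at hD
    simp [nilpotentFlow, hD]
  | succ n => simp [nilpotentFlow, Finset.sum_range_succ']

theorem nilpotentFlow_comm (t : ℝ) (v : V) :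
    nilpotentFlow D n t (D v) = D (nilpotentFlow D n t v) := by
  simp only [nilpotentFlow_apply, map_sum, map_smul]
  refine Finset.sum_congr rfl fun i _ => ?_
  rw [← Module.End.mul_apply, ← Module.End.mul_apply, ← pow_succ, ← pow_succ']

theorem hasDerivAt_apply_nilpotentFlow (hD : D ^ n = 0) (l : Module.Dual ℝ V) (v : V) (t : ℝ) :
    HasDerivAt (fun s => l (nilpotentFlow D n s v)) (l (D (nilpotentFlow D n t v))) t := by
  have h1 : HasDerivAt
      (fun s : ℝ => ∑ i ∈ Finset.range n, s ^ i / (i.factorial : ℝ) * l ((D ^ i) v))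
      (∑ i ∈ Finset.range n, (i * t ^ (i - 1)) / (i.factorial : ℝ) * l ((D ^ i) v)) t := by
    refine HasDerivAt.fun_sum fun i _ => ?_
    exact ((hasDerivAt_pow i t).div_const _).mul_const _
  have h2 : (fun s => l (nilpotentFlow D n s v)) =
      fun s : ℝ => ∑ i ∈ Finset.range n, s ^ i / (i.factorial : ℝ) * l ((D ^ i) v) := by
    funext s
    simp [nilpotentFlow_apply, map_sum]
  rw [h2]
  convert h1 using 1
  cases n with
  | zero => simp [nilpotentFlow]
  | succ n =>
    rw [← nilpotentFlow_comm, nilpotentFlow_apply, Finset.sum_range_succ, Finset.sum_range_succ',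
      ← Module.End.mul_apply, ← pow_succ, hD]
    simp only [map_sum, map_add, map_smul, smul_eq_mul, LinearMap.zero_apply, smul_zero, map_zero]
    simp only [Nat.cast_zero, zero_mul, zero_div]
    congr 1
    refine Finset.sum_congr rfl fun i _ => ?_
    rw [← Module.End.mul_apply, ← pow_succ, Nat.factorial_succ, Nat.add_sub_cancel]
    push_cast
    field_simp

/-- The product rule along the flow. -/
theorem hasDerivAt_bilin_nilpotentFlow [FiniteDimensional ℝ V] (hD : D ^ n = 0)
    (B : LinearMap.BilinForm ℝ V) (v w : V) (t : ℝ) :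
    HasDerivAt (fun s => B (nilpotentFlow D n s v) (nilpotentFlow D n s w))
      (B (D (nilpotentFlow D n t v)) (nilpotentFlow D n t w) +
        B (nilpotentFlow D n t v) (D (nilpotentFlow D n t w))) t := by
  let b := Module.finBasis ℝ V
  have hB : ∀ x y, B x y = ∑ i, b.repr x i * B (b i) y := by
    intro x y
    calc B x y = B (∑ i, b.repr x i • b i) y := by rw [b.sum_repr]
      _ = _ := by
        simp only [map_sum, map_smul, LinearMap.sum_apply, LinearMap.smul_apply, smul_eq_mul]
  have hfun : (fun s => B (nilpotentFlow D n s v) (nilpotentFlow D n s w)) = fun s =>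
      ∑ i, b.repr (nilpotentFlow D n s v) i * B (b i) (nilpotentFlow D n s w) :=
    funext fun s => hB _ _
  rw [hfun, hB (D _), hB (nilpotentFlow D n t v), ← Finset.sum_add_distrib]
  refine HasDerivAt.fun_sum fun i _ => ?_
  exact (hasDerivAt_apply_nilpotentFlow hD (b.coord i) v t).mul
    (hasDerivAt_apply_nilpotentFlow hD (B (b i)) w t)

/-- The flow commutes with `J` modulo a subspace that `D` kills, as soon as `D` does. -/
theorem nilpotentFlow_sub_mem (J : Module.End ℝ V) (W : Submodule ℝ V)
    (hW : ∀ w ∈ W, D w = 0) (hJ : ∀ v, D (J v) - J (D v) ∈ W) (t : ℝ) (v : V) :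
    nilpotentFlow D n t (J v) - J (nilpotentFlow D n t v) ∈ W := by
  have hpow : ∀ i, (D ^ i) (J v) - J ((D ^ i) v) ∈ W := by
    intro i
    induction i with
    | zero => simp
    | succ i ih =>
      have h1 := hJ ((D ^ i) v)
      have h2 := hW _ ih
      rw [map_sub, sub_eq_zero] at h2
      rw [pow_succ', Module.End.mul_apply, Module.End.mul_apply, h2]
      exact h1
  simp only [nilpotentFlow_apply, map_sum, map_smul, ← Finset.sum_sub_distrib, ← smul_sub]
  exact Submodule.sum_mem _ fun i _ => W.smul_mem _ (hpow i)

end Flow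

/-- The flow of a nilpotent derivation consists of Lie algebra automorphisms. -/
theorem nilpotentFlow_lie {L : Type*} [LieRing L] [LieAlgebra ℝ L] (x : L) {n : ℕ}
    (hD : LieAlgebra.ad ℝ L x ^ n = 0) (t : ℝ) (a b : L) :
    nilpotentFlow (LieAlgebra.ad ℝ L x) n t ⁅a, b⁆ =
      ⁅nilpotentFlow (LieAlgebra.ad ℝ L x) n t a, nilpotentFlow (LieAlgebra.ad ℝ L x) n t b⁆ := by
  let _ : Module ℚ L := Module.compHom L (algebraMap ℚ ℝ)
  have _ : IsScalarTower ℚ ℝ L := ⟨fun q r y => by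
    rw [Rat.smul_def, mul_smul]; rfl⟩
  let _ : LieAlgebra ℚ L := { lie_smul := fun q a b => lie_smul (q : ℝ) a b }
  have hn : (t • LieAlgebra.ad ℝ L x) ^ n = 0 := by rw [smul_pow, hD, smul_zero]
  have hE : IsNilpotent (LieDerivation.ad ℝ L (t • x)).toLinearMap := by
    refine ⟨n, ?_⟩
    convert hn using 2
    ext y
    simp
  have key : ∀ y, LieDerivation.exp _ hE y = nilpotentFlow (LieAlgebra.ad ℝ L x) n t y := by
    intro y
    have h0 : (LieDerivation.ad ℝ L (t • x)).toLinearMap = t • LieAlgebra.ad ℝ L x := by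
      ext y; simp
    rw [LieDerivation.exp_map_apply, nilpotentFlow_apply, h0, IsNilpotent.exp_eq_sum hn,
      LinearMap.sum_apply]
    refine Finset.sum_congr rfl fun i _ => ?_
    rw [LinearMap.smul_apply, smul_pow, LinearMap.smul_apply, ← Rat.cast_smul_eq_qsmul ℝ,
      smul_smul]
    congr 1
    push_cast
    ring
  rw [← key, ← key, ← key]
  exact (LieDerivation.exp _ hE).map_lie a b

/-! ### Nilpotent Lie algebras with an SKT metric: the centre is `J`-invariant -/

theorem ComplexStructure.lie_J_J {𝔤 : Type*} [LieRing 𝔤] [LieAlgebra ℝ 𝔤]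
    (C : ComplexStructure 𝔤) (x y : 𝔤) :
    ⁅C.J x, C.J y⁆ = ⁅x, y⁆ + C.J ⁅C.J x, y⁆ + C.J ⁅x, C.J y⁆ := by
  have := C.nijenhuis x y
  rw [sub_sub, sub_sub, sub_eq_zero] at this
  rw [this]; abel

namespace HermitianMetric

variable {𝔤 : Type*} [LieRing 𝔤] [LieAlgebra ℝ 𝔤] {C : ComplexStructure 𝔤}

theorem inner_J_left (g : HermitianMetric C) (x y : 𝔤) :
    g.inner (C.J x) y = -g.inner x (C.J y) := by
  have h := g.invariant x (C.J y)
  rw [C.J_sq, map_neg] at h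
  linarith

theorem inner_self_nonneg (g : HermitianMetric C) (x : 𝔤) : 0 ≤ g.inner x x := by
  by_cases h : x = 0
  · simp [h]
  · exact (g.pos x h).le

theorem eq_zero_of_inner_self_nonpos (g : HermitianMetric C) {x : 𝔤} (hx : g.inner x x ≤ 0) :
    x = 0 := by
  by_contra h
  exact absurd (g.pos x h) (not_lt.mpr hx)

theorem bismutTorsion_apply (g : HermitianMetric C) (x y z : 𝔤) :
    g.bismutTorsion x y z =
      -g.inner ⁅C.J x, C.J y⁆ z + g.inner ⁅C.J x, C.J z⁆ y - g.inner ⁅C.J y, C.J z⁆ x := by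
  simp only [bismutTorsion, d₂, fundamentalForm, g.invariant]

/-- Orthogonal projection, as a linear map, onto the orthogonal complement of a `J`-invariant
subspace `W`; it commutes with `J`. -/
theorem exists_projection [FiniteDimensional ℝ 𝔤] (g : HermitianMetric C) (W : Submodule ℝ 𝔤)
    (hW : ∀ w ∈ W, C.J w ∈ W) :
    ∃ P : 𝔤 →ₗ[ℝ] 𝔤, (∀ x, x - P x ∈ W) ∧ (∀ x, ∀ w ∈ W, g.inner (P x) w = 0) ∧
      (∀ w ∈ W, P w = 0) ∧ ∀ x, P (C.J x) = C.J (P x) := by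
  have hrefl : g.inner.IsRefl := fun x y h => by rw [g.symm]; exact h
  have hcompl : IsCompl W (g.inner.orthogonal W) := by
    rw [LinearMap.BilinForm.isCompl_orthogonal_iff_disjoint hrefl, Submodule.disjoint_def]
    intro x hx hx'
    exact g.eq_zero_of_inner_self_nonpos (hx' x hx).le
  have h1 : ∀ x, x - (g.inner.orthogonal W).projection W hcompl.symm x ∈ W :=
    fun x => Submodule.sub_projection_mem _ x
  have h2 : ∀ x, ∀ w ∈ W, g.inner ((g.inner.orthogonal W).projection W hcompl.symm x) w = 0 := by
    intro x w hw
    rw [g.symm]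
    exact Submodule.projection_apply_mem hcompl.symm x w hw
  refine ⟨(g.inner.orthogonal W).projection W hcompl.symm, h1, h2, fun w hw => ?_, fun x => ?_⟩
  · exact (Submodule.projection_apply_eq_zero_iff _).mpr hw
  · set P := (g.inner.orthogonal W).projection W hcompl.symm
    have hmem : P (C.J x) - C.J (P x) ∈ W := by
      have := W.sub_mem (hW _ (h1 x)) (h1 (C.J x))
      rw [map_sub] at this
      convert this using 1
      abel
    refine sub_eq_zero.mp (g.eq_zero_of_inner_self_nonpos (le_of_eq ?_))
    have hperp : ∀ w ∈ W, g.inner (P (C.J x) - C.J (P x)) w = 0 := fun w hw => by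
      rw [map_sub, LinearMap.sub_apply, h2 _ _ hw, g.inner_J_left, h2 _ _ (hW _ hw)]
      simp
    exact hperp _ hmem

/-- The SKT identity `dc(z, Jz, y, Jy) = 0` for a central `z`, on vectors where the terms of
second order in `D = ad (Jz)` vanish: it says `|Dy|² = 0`. -/
theorem lie_J_eq_zero_of_central (g : HermitianMetric C) (hskt : g.IsSKT) {z : 𝔤}
    (hz : ∀ x : 𝔤, ⁅z, x⁆ = 0) {y : 𝔤} (h2 : ⁅C.J z, ⁅C.J z, y⁆⁆ = 0)
    (hu : ⁅C.J z, ⁅y, C.J y⁆⁆ = 0) : ⁅C.J z, y⁆ = 0 := by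
  have hz' : ∀ x : 𝔤, ⁅x, z⁆ = 0 := fun x => by rw [← lie_skew, hz, neg_zero]
  have hcomm : ∀ x, ⁅C.J z, C.J x⁆ = C.J ⁅C.J z, x⁆ := fun x => by
    rw [C.lie_J_J, hz, hz]; simp
  have hcomm' : ∀ x, ⁅C.J x, C.J z⁆ = -C.J ⁅C.J z, x⁆ := fun x => by
    rw [← lie_skew, hcomm]
  -- The derivation property of `D` on `[y, Jy]`.
  have hder : ⁅⁅C.J z, y⁆, C.J y⁆ = ⁅C.J ⁅C.J z, y⁆, y⁆ := by
    have := leibniz_lie (C.J z) y (C.J y)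
    rw [hu, hcomm, ← lie_skew y, eq_comm, ← sub_eq_add_neg, sub_eq_zero] at this
    exact this
  have h2' : ⁅⁅C.J z, y⁆, C.J z⁆ = 0 := by rw [← lie_skew, h2, neg_zero]
  have h := hskt z (C.J z) y (C.J y)
  simp only [d₃, bismutTorsion_apply, hz, hz', hcomm, hcomm', C.J_sq, h2, h2', hu, lie_neg, neg_lie,
    map_neg, LinearMap.neg_apply, map_zero, LinearMap.zero_apply, zero_lie, g.invariant, hder] at h
  refine g.eq_zero_of_inner_self_nonpos ?_
  linarith

/-- On a nilpotent Lie algebra, an SKT complex structure preserves the centre. -/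
theorem lie_J_eq_zero_of_isSKT [LieRing.IsNilpotent 𝔤] (g : HermitianMetric C) (hskt : g.IsSKT)
    {z : 𝔤} (hz : ∀ x : 𝔤, ⁅z, x⁆ = 0) (y : 𝔤) : ⁅C.J z, y⁆ = 0 := by
  refine lowerCentralSeries_induction (p := fun y : 𝔤 => ⁅C.J z, y⁆ = (0 : 𝔤)) (lie_zero _)
    (fun k ih y hy => ?_) y
  refine g.lie_J_eq_zero_of_central hskt hz (ih _ (lie_mem_lowerCentralSeries_succ _ hy)) (ih _ ?_)
  rw [← lie_skew]
  exact neg_mem (lie_mem_lowerCentralSeries_succ _ hy)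

/-! ### SKT metrics and the second centre -/

/-- The identity `dc(z, Jz, y, Jy) = 0` for `z` central modulo a `J`-invariant central
subspace `W`, and `y`, `z` orthogonal to `W`. The left side is the second derivative at `t = 0` of
the squared norm of `exp (t ad (Jz)) y` modulo `W`, plus squares; the right side is linear in the
bracket `[y, Jy]`. -/
theorem skt_second_center (g : HermitianMetric C) (hskt : g.IsSKT) {W : Submodule ℝ 𝔤}
    (hWc : ∀ w ∈ W, ∀ x : 𝔤, ⁅w, x⁆ = 0) (hWJ : ∀ w ∈ W, C.J w ∈ W) {z : 𝔤}
    (hz : ∀ x, ⁅z, x⁆ ∈ W) (hzW : ∀ w ∈ W, g.inner w z = 0) {y : 𝔤}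
    (hyW : ∀ w ∈ W, g.inner w y = 0) :
    2 * g.inner ⁅C.J z, ⁅C.J z, y⁆⁆ y + g.inner ⁅C.J z, y⁆ ⁅C.J z, y⁆ +
        g.inner ⁅C.J z, C.J y⁆ ⁅C.J z, C.J y⁆ + g.inner ⁅z, y⁆ ⁅z, y⁆ +
        g.inner ⁅z, C.J y⁆ ⁅z, C.J y⁆ =
      2 * g.inner ⁅y, C.J y⁆ ⁅z, C.J z⁆ - 2 * g.inner ⁅C.J z, ⁅y, C.J y⁆⁆ z := by
  have hWc' : ∀ w ∈ W, ∀ x : 𝔤, ⁅x, w⁆ = 0 := fun w hw x => by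
    rw [← lie_skew, hWc w hw, neg_zero]
  have hcz : ∀ a x : 𝔤, ⁅⁅z, a⁆, x⁆ = 0 := fun a => hWc _ (hz a)
  have hcJz : ∀ a x : 𝔤, ⁅C.J ⁅z, a⁆, x⁆ = 0 := fun a => hWc _ (hWJ _ (hz a))
  have hJlie : ∀ a : 𝔤, ⁅C.J z, C.J a⁆ = ⁅z, a⁆ + C.J ⁅C.J z, a⁆ + C.J ⁅z, C.J a⁆ := C.lie_J_J z
  have hr : ∀ x : 𝔤, ⁅C.J ⁅C.J z, C.J y⁆, x⁆ = -⁅⁅C.J z, y⁆, x⁆ := fun x => by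
    rw [hJlie, map_add, map_add, C.J_sq, C.J_sq, add_lie, add_lie, hcJz, neg_lie, neg_lie, hcz]
    simp
  have hJD : ∀ a b : 𝔤, (∀ w ∈ W, g.inner w b = 0) →
      g.inner ⁅C.J a, C.J z⁆ (C.J b) = -g.inner ⁅C.J z, a⁆ b := by
    intro a b hb
    rw [← lie_skew, hJlie]
    simp only [map_neg, map_add, LinearMap.neg_apply, LinearMap.add_apply, g.invariant]
    have h0 := hb _ (hWJ _ (hz a))
    rw [g.inner_J_left] at h0
    linarith [hb _ (hz (C.J a))]
  have hJu : ∀ a : 𝔤, g.inner ⁅a, z⁆ z = 0 := fun a => by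
    rw [← lie_skew, map_neg, LinearMap.neg_apply, hzW _ (hz a), neg_zero]
  have hder : g.inner ⁅C.J z, ⁅y, C.J y⁆⁆ z =
      g.inner ⁅⁅C.J z, y⁆, C.J y⁆ z - g.inner ⁅C.J ⁅C.J z, y⁆, y⁆ z := by
    rw [leibniz_lie, hJlie, lie_add, lie_add, hWc' _ (hz y), hWc' _ (hWJ _ (hz _)),
      ← lie_skew y (C.J _), add_zero, zero_add, map_add, map_neg, LinearMap.add_apply,
      LinearMap.neg_apply, sub_eq_add_neg]
  have h1 := hJD ⁅C.J z, y⁆ y hyW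
  have h2 := hJD ⁅y, C.J y⁆ z hzW
  have h3 : g.inner ⁅⁅C.J z, y⁆, C.J z⁆ y = -g.inner ⁅C.J z, ⁅C.J z, y⁆⁆ y := by
    rw [← lie_skew, map_neg, LinearMap.neg_apply]
  have h4 : ⁅C.J z, z⁆ = -⁅z, C.J z⁆ := (lie_skew _ _).symm
  have h5 : ⁅C.J y, y⁆ = -⁅y, C.J y⁆ := (lie_skew _ _).symm
  have hsym := g.symm ⁅y, C.J y⁆ ⁅z, C.J z⁆
  have h := hskt z (C.J z) y (C.J y)
  simp only [d₃, bismutTorsion_apply, C.J_sq, hcJz, hr, lie_neg, neg_lie, map_neg,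
    LinearMap.neg_apply, map_zero, LinearMap.zero_apply, hJu, h1, h2, h3, h4, h5] at h
  linarith

/-- `skt_second_center` read on the quotient by `W`, where the metric is `⟨P ·, P ·⟩`. -/
theorem skt_second_center_projection (g : HermitianMetric C) (hskt : g.IsSKT) {W : Submodule ℝ 𝔤}
    (hWc : ∀ w ∈ W, ∀ x : 𝔤, ⁅w, x⁆ = 0) (hWJ : ∀ w ∈ W, C.J w ∈ W) {P : 𝔤 →ₗ[ℝ] 𝔤}
    (hPsub : ∀ x, x - P x ∈ W) (hPperp : ∀ x, ∀ w ∈ W, g.inner (P x) w = 0)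
    (hPW : ∀ w ∈ W, P w = 0) (hPJ : ∀ x, P (C.J x) = C.J (P x)) {z : 𝔤}
    (hz : ∀ x, ⁅z, x⁆ ∈ W) (hzW : ∀ w ∈ W, g.inner w z = 0) (y : 𝔤) :
    2 * g.inner (P ⁅C.J z, ⁅C.J z, y⁆⁆) (P y) + 2 * g.inner (P ⁅C.J z, y⁆) (P ⁅C.J z, y⁆) +
        g.inner ⁅z, y⁆ ⁅z, y⁆ ≤
      2 * g.inner ⁅y, C.J y⁆ ⁅z, C.J z⁆ - 2 * g.inner ⁅C.J z, ⁅y, C.J y⁆⁆ z := by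
  have hbr : ∀ a x : 𝔤, ⁅a, P x⁆ = ⁅a, x⁆ := fun a x => by
    have := hWc _ (hPsub x) a
    rw [sub_lie, sub_eq_zero, ← lie_skew, ← lie_skew (P x), neg_inj] at this
    exact this.symm
  have hbr' : ∀ a x : 𝔤, ⁅P x, a⁆ = ⁅x, a⁆ := fun a x => by
    rw [← lie_skew, hbr, lie_skew]
  -- Pythagoras: projecting decreases norms.
  have hsplit : ∀ x v, g.inner x (P v) = g.inner (P x) (P v) := fun x v => by
    have := hPperp v _ (hPsub x)
    rw [g.symm, map_sub, LinearMap.sub_apply] at this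
    linarith
  have hle : ∀ x, g.inner (P x) (P x) ≤ g.inner x x := fun x => by
    have h1 := g.inner_self_nonneg (x - P x)
    simp only [map_sub, LinearMap.sub_apply] at h1
    have h2 := hsplit x x
    have h3 := g.symm x (P x)
    linarith
  have h := g.skt_second_center hskt hWc hWJ hz hzW (y := P y)
    (fun w hw => by rw [g.symm]; exact hPperp y w hw)
  rw [← hPJ] at h
  simp only [hbr, hbr'] at h
  rw [hsplit] at h
  have hPr : P ⁅C.J z, C.J y⁆ = C.J (P ⁅C.J z, y⁆) := by
    rw [C.lie_J_J, map_add, map_add, hPW _ (hz _), hPW _ (hWJ _ (hz _)), hPJ]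
    simp
  have h1 := hle ⁅C.J z, y⁆
  have h2 := hle ⁅C.J z, C.J y⁆
  rw [hPr, g.invariant] at h2
  have h3 := g.inner_self_nonneg ⁅z, C.J y⁆
  linarith

/-- If the bracket kills the bivector `∑ eᵢ ∧ J eᵢ` of a basis `e`, then under an SKT metric an
element that is central modulo a `J`-invariant central subspace, and orthogonal to it, is central.
Let `F t` be the sum over `i` of the squared norms of `exp (t ad (Jz)) eᵢ` modulo the subspace. The
linear terms of the SKT identity add up to zero along the flow, so `F'' ≤ -∑ |[z, ·]|² ≤ 0`; as `F`
is nonnegative on the whole line, this forces `F'' = 0` and `[z, eᵢ] = 0`. -/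
theorem lie_eq_zero_of_lie_mem_center_of_perp [FiniteDimensional ℝ 𝔤] [LieRing.IsNilpotent 𝔤]
    (g : HermitianMetric C) (hskt : g.IsSKT) {W : Submodule ℝ 𝔤}
    (hWc : ∀ w ∈ W, ∀ x : 𝔤, ⁅w, x⁆ = 0) (hWJ : ∀ w ∈ W, C.J w ∈ W)
    {ι : Type*} [Fintype ι] (e : Module.Basis ι ℝ 𝔤) (he : ∑ i, ⁅e i, C.J (e i)⁆ = 0)
    {z : 𝔤} (hz : ∀ x, ⁅z, x⁆ ∈ W) (hzW : ∀ w ∈ W, g.inner w z = 0) (x : 𝔤) : ⁅z, x⁆ = 0 := by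
  obtain ⟨P, hPsub, hPperp, hPW, hPJ⟩ := g.exists_projection W hWJ
  obtain ⟨n, hn⟩ := LieModule.isNilpotent_toEnd_of_isNilpotent ℝ 𝔤 𝔤 (C.J z)
  set D : Module.End ℝ 𝔤 := LieAlgebra.ad ℝ 𝔤 (C.J z) with hD
  have hDn : D ^ n = 0 := hn
  have hDa : ∀ a, D a = ⁅C.J z, a⁆ := fun a => rfl
  let q : LinearMap.BilinForm ℝ 𝔤 := g.inner.compl₁₂ P P
  have hq : ∀ a b, q a b = g.inner (P a) (P b) := fun a b => rfl
  let φ := nilpotentFlow D n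
  have hbase := fun y => g.skt_second_center_projection hskt hWc hWJ hPsub hPperp hPW hPJ hz hzW y
  -- The flow preserves the bracket, and commutes with `J` up to central elements.
  have hφ : ∀ t, ∑ i, ⁅φ t (e i), C.J (φ t (e i))⁆ = 0 := by
    intro t
    have h1 : ∀ i, ⁅φ t (e i), C.J (φ t (e i))⁆ = φ t ⁅e i, C.J (e i)⁆ := by
      intro i
      have hmem : φ t (C.J (e i)) - C.J (φ t (e i)) ∈ W := by
        refine nilpotentFlow_sub_mem C.J W (fun w hw => ?_) (fun v => ?_) t (e i)
        · rw [hDa, ← lie_skew, hWc w hw, neg_zero]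
        · rw [hDa, hDa, C.lie_J_J]
          convert W.add_mem (hz v) (hWJ _ (hz (C.J v))) using 1
          abel
      have h2 := hWc _ hmem (φ t (e i))
      rw [sub_lie, sub_eq_zero, ← lie_skew, ← lie_skew (C.J _), neg_inj] at h2
      rw [← h2]
      exact (nilpotentFlow_lie (C.J z) hDn t _ _).symm
    rw [Finset.sum_congr rfl fun i _ => h1 i, ← map_sum, he, map_zero]
  have hsum : ∀ t, ∑ i, (2 * (q (D (D (φ t (e i)))) (φ t (e i)) +
      q (D (φ t (e i))) (D (φ t (e i)))) + g.inner ⁅z, φ t (e i)⁆ ⁅z, φ t (e i)⁆) ≤ 0 := by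
    intro t
    have h1 : ∑ i, (2 * (q (D (D (φ t (e i)))) (φ t (e i)) +
        q (D (φ t (e i))) (D (φ t (e i)))) + g.inner ⁅z, φ t (e i)⁆ ⁅z, φ t (e i)⁆) ≤
        ∑ i, (2 * g.inner ⁅φ t (e i), C.J (φ t (e i))⁆ ⁅z, C.J z⁆ -
          2 * g.inner ⁅C.J z, ⁅φ t (e i), C.J (φ t (e i))⁆⁆ z) := by
      refine Finset.sum_le_sum fun i _ => ?_
      have := hbase (φ t (e i))
      simp only [hq, hDa]
      linarith
    refine h1.trans (le_of_eq ?_)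
    rw [Finset.sum_sub_distrib, ← Finset.mul_sum, ← Finset.mul_sum]
    have h2 : ∑ i, g.inner ⁅φ t (e i), C.J (φ t (e i))⁆ ⁅z, C.J z⁆ = 0 := by
      rw [← LinearMap.sum_apply, ← map_sum, hφ]; simp
    have h3 : ∑ i, g.inner ⁅C.J z, ⁅φ t (e i), C.J (φ t (e i))⁆⁆ z = 0 := by
      rw [← LinearMap.sum_apply, ← map_sum, ← lie_sum, hφ]; simp
    rw [h2, h3]; simp
  have hpos : ∀ t i, 0 ≤ g.inner ⁅z, φ t (e i)⁆ ⁅z, φ t (e i)⁆ := fun t i => g.inner_self_nonneg _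
  have hsym : ∀ a b, q a b = q b a := fun a b => g.symm _ _
  have hzero := second_deriv_eq_zero_of_nonneg_of_nonpos
    (f := fun t => ∑ i, q (φ t (e i)) (φ t (e i)))
    (f' := fun t => ∑ i, 2 * q (D (φ t (e i))) (φ t (e i)))
    (f'' := fun t => ∑ i, 2 * (q (D (D (φ t (e i)))) (φ t (e i)) +
      q (D (φ t (e i))) (D (φ t (e i)))))
    (fun t => by
      refine HasDerivAt.fun_sum fun i _ => ?_
      have := hasDerivAt_bilin_nilpotentFlow hDn q (e i) (e i) t
      rw [hsym _ (D _), ← two_mul] at this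
      exact this)
    (fun t => by
      refine HasDerivAt.fun_sum fun i _ => ?_
      have := (hasDerivAt_bilin_nilpotentFlow hDn q (D (e i)) (e i) t).const_mul 2
      simp only [nilpotentFlow_comm] at this
      exact this)
    (fun t => Finset.sum_nonneg fun i _ => g.inner_self_nonneg _)
    (fun t => by
      have h1 := hsum t
      rw [Finset.sum_add_distrib] at h1
      linarith [Finset.sum_nonneg fun i (_ : i ∈ Finset.univ) => hpos t i]) 0
  have h0 := hsum 0
  rw [Finset.sum_add_distrib] at h0
  have hφ0 : φ 0 = 1 := nilpotentFlow_zero hDn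
  have hnorm : ∑ i, g.inner ⁅z, e i⁆ ⁅z, e i⁆ ≤ 0 := by
    simp only [hφ0, Module.End.one_apply] at h0 hzero
    linarith
  have hei : ∀ i, ⁅z, e i⁆ = 0 := fun i => g.eq_zero_of_inner_self_nonpos <|
    (Finset.single_le_sum (fun j _ => g.inner_self_nonneg ⁅z, e j⁆) (Finset.mem_univ i)).trans hnorm
  have : LieAlgebra.ad ℝ 𝔤 z = 0 := e.ext fun i => hei i
  exact LinearMap.congr_fun this x

/-- A nilpotent Lie algebra with an SKT metric, on which the bivector `∑ eᵢ ∧ J eᵢ` of some basis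
`e` is killed by the bracket (as happens when there is also a balanced metric), is abelian. -/
theorem lie_eq_zero_of_isSKT_of_sum_lie_eq_zero [FiniteDimensional ℝ 𝔤] [LieRing.IsNilpotent 𝔤]
    (g : HermitianMetric C) (hskt : g.IsSKT) {ι : Type*} [Fintype ι] (e : Module.Basis ι ℝ 𝔤)
    (he : ∑ i, ⁅e i, C.J (e i)⁆ = 0) (x y : 𝔤) : ⁅x, y⁆ = 0 := by
  let W : Submodule ℝ 𝔤 := LinearMap.ker (LieAlgebra.ad ℝ 𝔤 : 𝔤 →ₗ[ℝ] Module.End ℝ 𝔤)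
  have hW : ∀ w, w ∈ W ↔ ∀ x : 𝔤, ⁅w, x⁆ = 0 := fun w => by
    rw [LinearMap.mem_ker]
    exact ⟨fun h x => LinearMap.congr_fun h x, fun h => LinearMap.ext h⟩
  have hWJ : ∀ w ∈ W, C.J w ∈ W := fun w hw =>
    (hW _).mpr (g.lie_J_eq_zero_of_isSKT hskt ((hW w).mp hw))
  obtain ⟨P, hPsub, hPperp, -, -⟩ := g.exists_projection W hWJ
  refine (hW x).mp
    (lowerCentralSeries_induction (p := (· ∈ W)) W.zero_mem (fun k ih z hz => ?_) x) y
  have hlie : ∀ v, ⁅z, v⁆ ∈ W := fun v => by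
    rw [← lie_skew]
    exact W.neg_mem (ih _ (lie_mem_lowerCentralSeries_succ v hz))
  have hPz : ∀ v, ⁅P z, v⁆ = ⁅z, v⁆ := fun v => by
    have := (hW _).mp (hPsub z) v
    rw [sub_lie, sub_eq_zero] at this
    exact this.symm
  refine (hW z).mpr fun v => ?_
  rw [← hPz]
  refine g.lie_eq_zero_of_lie_mem_center_of_perp hskt (fun w hw => (hW w).mp hw) hWJ e he
    (fun v => ?_) (fun w hw => ?_) v
  · rw [hPz]; exact hlie v
  · rw [g.symm]; exact hPperp z w hw

end HermitianMetric

/-! ### Traces in an orthonormal basis -/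

section OrthonormalBasis

variable {V : Type*} [AddCommGroup V] [Module ℝ V] {B : LinearMap.BilinForm ℝ V} {ι : Type*}
  [Fintype ι] [DecidableEq ι] {e : Module.Basis ι ℝ V}

theorem repr_eq_of_orthonormal (he : ∀ i j, B (e i) (e j) = if i = j then 1 else 0) (v : V)
    (i : ι) : e.repr v i = B v (e i) := by
  conv_rhs => rw [← e.sum_repr v]
  simp only [map_sum, map_smul, LinearMap.sum_apply, LinearMap.smul_apply, smul_eq_mul, he]
  simp

theorem trace_eq_sum_of_orthonormal (he : ∀ i j, B (e i) (e j) = if i = j then 1 else 0)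
    (T : Module.End ℝ V) : LinearMap.trace ℝ V T = ∑ i, B (T (e i)) (e i) := by
  rw [LinearMap.trace_eq_matrix_trace ℝ e, Matrix.trace]
  simp [LinearMap.toMatrix_apply, repr_eq_of_orthonormal he]

theorem apply_eq_sum_of_orthonormal (he : ∀ i j, B (e i) (e j) = if i = j then 1 else 0)
    (u v : V) : B u v = ∑ j, B u (e j) * B (e j) v := by
  calc B u v = B (∑ j, e.repr u j • e j) v := by rw [e.sum_repr]
    _ = _ := by
      simp only [map_sum, map_smul, LinearMap.sum_apply, LinearMap.smul_apply, smul_eq_mul,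
        repr_eq_of_orthonormal he]

/-- `tr (T²) - |T|² = -|T - Tᵗ|² / 2`. -/
theorem sum_sq_sub_norm_eq (hs : ∀ x y, B x y = B y x)
    (he : ∀ i j, B (e i) (e j) = if i = j then 1 else 0) (T : Module.End ℝ V) :
    ∑ i, (B (T (T (e i))) (e i) - B (T (e i)) (T (e i))) =
      -(1 / 2) * ∑ i, ∑ j, (B (T (e i)) (e j) - B (T (e j)) (e i)) ^ 2 := by
  have h1 : ∀ i, B (T (T (e i))) (e i) = ∑ j, B (T (e i)) (e j) * B (T (e j)) (e i) := by
    intro i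
    calc B (T (T (e i))) (e i) = B (T (∑ j, e.repr (T (e i)) j • e j)) (e i) := by rw [e.sum_repr]
      _ = _ := by
        simp only [map_sum, map_smul, LinearMap.sum_apply, LinearMap.smul_apply, smul_eq_mul,
          repr_eq_of_orthonormal he]
  have h2 : ∀ i, B (T (e i)) (T (e i)) = ∑ j, B (T (e i)) (e j) ^ 2 := by
    intro i
    rw [apply_eq_sum_of_orthonormal he]
    exact Finset.sum_congr rfl fun j _ => by rw [hs (e j), sq]
  have h3 : ∑ i, ∑ j, B (T (e j)) (e i) ^ 2 = ∑ i, ∑ j, B (T (e i)) (e j) ^ 2 :=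
    Finset.sum_comm
  have h4 : ∀ i j, (B (T (e i)) (e j) - B (T (e j)) (e i)) ^ 2 = B (T (e i)) (e j) ^ 2 +
      B (T (e j)) (e i) ^ 2 - 2 * (B (T (e i)) (e j) * B (T (e j)) (e i)) := fun i j => by ring
  simp only [h1, h2, h4, Finset.sum_sub_distrib, Finset.sum_add_distrib, ← Finset.mul_sum, h3]
  ring

theorem sum_sq_sub_norm_nonpos (hs : ∀ x y, B x y = B y x)
    (he : ∀ i j, B (e i) (e j) = if i = j then 1 else 0) (T : Module.End ℝ V) :
    ∑ i, (B (T (T (e i))) (e i) - B (T (e i)) (T (e i))) ≤ 0 := by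
  rw [sum_sq_sub_norm_eq hs he]
  have : 0 ≤ ∑ i, ∑ j, (B (T (e i)) (e j) - B (T (e j)) (e i)) ^ 2 :=
    Finset.sum_nonneg fun i _ => Finset.sum_nonneg fun j _ => sq_nonneg _
  linarith

theorem symmetric_of_sum_sq_sub_norm_nonneg (hs : ∀ x y, B x y = B y x)
    (he : ∀ i j, B (e i) (e j) = if i = j then 1 else 0) (T : Module.End ℝ V)
    (h : 0 ≤ ∑ i, (B (T (T (e i))) (e i) - B (T (e i)) (T (e i)))) (a b : V) :
    B (T a) b = B (T b) a := by
  rw [sum_sq_sub_norm_eq hs he] at h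
  have hnn : ∀ i ∈ Finset.univ, 0 ≤ ∑ j, (B (T (e i)) (e j) - B (T (e j)) (e i)) ^ 2 :=
    fun i _ => Finset.sum_nonneg fun j _ => sq_nonneg _
  have h0 : ∑ i, ∑ j, (B (T (e i)) (e j) - B (T (e j)) (e i)) ^ 2 = 0 :=
    le_antisymm (by linarith) (Finset.sum_nonneg hnn)
  have h1 : ∀ i j, B (T (e i)) (e j) = B (T (e j)) (e i) := by
    intro i j
    have h2 := (Finset.sum_eq_zero_iff_of_nonneg hnn).mp h0 i (Finset.mem_univ i)
    have h3 := (Finset.sum_eq_zero_iff_of_nonneg fun j _ => sq_nonneg _).mp h2 j (Finset.mem_univ j)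
    exact sub_eq_zero.mp (pow_eq_zero_iff two_ne_zero |>.mp h3)
  have h2 : B.compl₁₂ T LinearMap.id = (B.compl₁₂ T LinearMap.id).flip :=
    e.ext fun i => e.ext fun j => h1 i j
  exact LinearMap.congr_fun₂ h2 a b

end OrthonormalBasis

namespace HermitianMetric

variable {𝔤 : Type*} [LieRing 𝔤] [LieAlgebra ℝ 𝔤] {C : ComplexStructure 𝔤}

/-! ### Balanced metrics on unimodular Lie algebras -/

theorem inner_leviCivita [FiniteDimensional ℝ 𝔤] (g : HermitianMetric C) (x y z : 𝔤) :
    g.inner (g.leviCivita x y) z =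
      1 / 2 * (g.inner ⁅x, y⁆ z - g.inner ⁅y, z⁆ x + g.inner ⁅z, x⁆ y) := by
  rw [leviCivita, LinearMap.BilinForm.apply_toDual_symm_apply]
  rfl

/-- On a unimodular Lie algebra the codifferential of the fundamental form is dual to half the
bracket of the bivector `∑ eᵢ ∧ J eᵢ`. -/
theorem codifferential_fundamentalForm [FiniteDimensional ℝ 𝔤] (hunim : IsUnimodular 𝔤)
    (g : HermitianMetric C) {ι : Type*} [Fintype ι] [DecidableEq ι] (e : Module.Basis ι ℝ 𝔤)
    (he : ∀ i j, g.inner (e i) (e j) = if i = j then 1 else 0) (x : 𝔤) :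
    g.codifferential e g.fundamentalForm x =
      -(1 / 2) * g.inner (∑ i, ⁅e i, C.J (e i)⁆) x := by
  have h1 : ∑ i, g.inner ⁅C.J x, e i⁆ (e i) = 0 :=
    (trace_eq_sum_of_orthonormal he (LieAlgebra.ad ℝ 𝔤 (C.J x))).symm.trans (hunim _)
  have h2 : ∑ i, g.inner (C.J ⁅x, e i⁆) (e i) = ∑ i, g.inner ⁅x, C.J (e i)⁆ (e i) :=
    (trace_eq_sum_of_orthonormal he (C.J * LieAlgebra.ad ℝ 𝔤 x)).symm.trans
      ((LinearMap.trace_mul_comm ℝ _ _).trans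
        (trace_eq_sum_of_orthonormal he (LieAlgebra.ad ℝ 𝔤 x * C.J)))
  have h3 : ∀ i, g.covDeriv g.fundamentalForm (e i) (e i) x =
      g.inner ⁅C.J x, e i⁆ (e i) - 1 / 2 * (g.inner (C.J ⁅x, e i⁆) (e i) -
        g.inner ⁅x, C.J (e i)⁆ (e i) - g.inner ⁅e i, C.J (e i)⁆ x) := by
    intro i
    rw [covDeriv, fundamentalForm, fundamentalForm, g.inner_J_left (g.leviCivita _ _),
      g.symm (C.J (e i)), inner_leviCivita, inner_leviCivita, g.inner_J_left ⁅x, e i⁆,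
      ← lie_skew x (e i), ← lie_skew (e i) (C.J (e i)), ← lie_skew (C.J x) (e i)]
    simp only [lie_self, map_neg, map_zero, LinearMap.neg_apply, LinearMap.zero_apply]
    ring
  rw [codifferential, Finset.sum_congr rfl fun i _ => h3 i, Finset.sum_sub_distrib, h1,
    ← Finset.mul_sum, Finset.sum_sub_distrib, Finset.sum_sub_distrib, h2, map_sum,
    LinearMap.sum_apply]
  ring

theorem sum_lie_eq_zero_of_isBalanced [FiniteDimensional ℝ 𝔤] (hunim : IsUnimodular 𝔤)
    (g : HermitianMetric C) (hbal : g.IsBalanced) {ι : Type*} [Fintype ι] [DecidableEq ι]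
    (e : Module.Basis ι ℝ 𝔤) (he : ∀ i j, g.inner (e i) (e j) = if i = j then 1 else 0) :
    ∑ i, ⁅e i, C.J (e i)⁆ = 0 := by
  let r : ι ≃ Fin (Module.finrank ℝ 𝔤) :=
    Fintype.equivFinOfCardEq (Module.finrank_eq_card_basis e).symm
  have hr : ∀ i j, g.inner (e.reindex r i) (e.reindex r j) = if i = j then 1 else 0 := by
    intro i j
    simp [he]
  have h1 : ∀ x, g.inner (∑ i, ⁅e.reindex r i, C.J (e.reindex r i)⁆) x = 0 := by
    intro x
    have := hbal _ hr x
    rw [g.codifferential_fundamentalForm hunim _ hr] at this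
    linarith
  have h2 : ∑ i, ⁅e.reindex r i, C.J (e.reindex r i)⁆ = 0 :=
    g.eq_zero_of_inner_self_nonpos (h1 _).le
  rw [← h2, ← r.sum_comp]
  simp

end HermitianMetric

/-! ### Restriction to ideals, and SKT metrics along abelian ideals -/

/-- The complex structure induced on a `J`-invariant ideal. -/
def ComplexStructure.restrict {𝔤 : Type*} [LieRing 𝔤] [LieAlgebra ℝ 𝔤] (C : ComplexStructure 𝔤)
    (h : LieIdeal ℝ 𝔤) (hJ : ∀ x ∈ h, C.J x ∈ h) : ComplexStructure h where
  J :=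
    { toFun := fun x => ⟨C.J x, hJ x x.2⟩
      map_add' := fun x y => Subtype.ext (map_add C.J (x : 𝔤) y)
      map_smul' := fun r x => Subtype.ext (map_smul C.J r (x : 𝔤)) }
  J_sq x := Subtype.ext (C.J_sq x)
  nijenhuis x y := Subtype.ext (C.nijenhuis x y)

namespace HermitianMetric

variable {𝔤 : Type*} [LieRing 𝔤] [LieAlgebra ℝ 𝔤] {C : ComplexStructure 𝔤}

/-- The Hermitian metric induced on a `J`-invariant ideal. -/
def restrict (g : HermitianMetric C) (h : LieIdeal ℝ 𝔤) (hJ : ∀ x ∈ h, C.J x ∈ h) :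
    HermitianMetric (C.restrict h hJ) where
  inner := g.inner.restrict h.toSubmodule
  symm x y := g.symm x y
  pos x hx := g.pos x fun h0 => hx (Subtype.ext h0)
  invariant x y := g.invariant x y

theorem isSKT_restrict {g : HermitianMetric C} (hskt : g.IsSKT) (h : LieIdeal ℝ 𝔤)
    (hJ : ∀ x ∈ h, C.J x ∈ h) : (g.restrict h hJ).IsSKT :=
  fun w x y z => hskt w x y z

/-- For an SKT metric and an abelian `J`-invariant ideal, every `J ∘ ad x` acts on the ideal as a
symmetric operator. Tracing `dc(x, Jx, y, Jy) = 0` over `y` in the ideal turns it into the vanishing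
of a sum of squared norms of skew-symmetric parts. -/
theorem inner_J_lie_symm_of_isSKT [FiniteDimensional ℝ 𝔤] (g : HermitianMetric C)
    (hskt : g.IsSKT) (h : LieIdeal ℝ 𝔤) (hJ : ∀ x ∈ h, C.J x ∈ h)
    (hab : ∀ a ∈ h, ∀ b ∈ h, ⁅a, b⁆ = 0) (hder : ∀ a b : 𝔤, ⁅a, b⁆ ∈ h) (x : 𝔤)
    {a b : 𝔤} (ha : a ∈ h) (hb : b ∈ h) :
    g.inner (C.J ⁅x, a⁆) b = g.inner (C.J ⁅x, b⁆) a := by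
  let gh := g.restrict h hJ
  let J : Module.End ℝ h := (C.restrict h hJ).J
  let A : Module.End ℝ h := LieModule.toEnd ℝ 𝔤 h x
  let B : Module.End ℝ h := LieModule.toEnd ℝ 𝔤 h (C.J x)
  obtain ⟨e, he⟩ := exists_orthonormal_basis gh.inner gh.symm gh.pos
  let Q : Module.End ℝ h → Fin (Module.finrank ℝ h) → ℝ := fun T i =>
    gh.inner (T (T (e i))) (e i) - gh.inner (T (e i)) (T (e i))
  have hpt : ∀ i, Q (J * A) i + Q (A * J) i + Q (J * B) i + Q (B * J) i = 0 := by
    intro i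
    obtain ⟨y, hy⟩ : ∃ y : h, y = e i := ⟨_, rfl⟩
    have hQ1 : ∀ T : Module.End ℝ h, Q (J * T) i =
        -gh.inner (T (J (T y))) (J y) - gh.inner (T y) (T y) := by
      intro T
      simp only [Q, Module.End.mul_apply, ← hy]
      rw [gh.inner_J_left, gh.invariant]
    have hQ2 : ∀ T : Module.End ℝ h, Q (T * J) i =
        gh.inner (T (J (T (J y)))) y - gh.inner (T (J y)) (T (J y)) := by
      intro T
      simp only [Q, Module.End.mul_apply, ← hy]
    have hJy := hJ _ y.2
    have hhhh : ∀ u ∈ h, ∀ v ∈ h, ∀ w ∈ h, g.bismutTorsion u v w = 0 := fun u hu v hv w hw => by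
      rw [bismutTorsion_apply, hab _ (hJ u hu) _ (hJ v hv), hab _ (hJ u hu) _ (hJ w hw),
        hab _ (hJ v hv) _ (hJ w hw)]
      simp
    have hhxh : ∀ v, ∀ u ∈ h, ∀ w ∈ h, g.bismutTorsion u v w =
        g.inner ⁅C.J v, C.J u⁆ w - g.inner ⁅C.J v, C.J w⁆ u := fun v u hu w hw => by
      rw [bismutTorsion_apply, hab _ (hJ u hu) _ (hJ w hw), ← lie_skew (C.J u) (C.J v),
        map_neg, map_zero, LinearMap.neg_apply, LinearMap.zero_apply]
      ring
    have h0 : ∀ v w, g.bismutTorsion 0 v w = 0 := fun v w => by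
      rw [bismutTorsion_apply]; simp
    have hd := hskt x (C.J x) y (C.J y)
    rw [d₃, hab _ y.2 _ hJy, h0, hhhh _ (hder _ _) _ y.2 _ hJy, hhxh _ _ (hder _ _) _ hJy,
      hhxh _ _ (hder _ _) _ y.2, hhxh _ _ (hder _ _) _ hJy, hhxh _ _ (hder _ _) _ y.2] at hd
    simp only [C.J_sq, lie_neg, neg_lie, map_neg, LinearMap.neg_apply] at hd
    rw [hQ1, hQ2, hQ1, hQ2]
    change -g.inner ⁅x, C.J ⁅x, (y : 𝔤)⁆⁆ (C.J y) - g.inner ⁅x, (y : 𝔤)⁆ ⁅x, (y : 𝔤)⁆ +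
      (g.inner ⁅x, C.J ⁅x, C.J y⁆⁆ y - g.inner ⁅x, C.J y⁆ ⁅x, C.J y⁆) +
      (-g.inner ⁅C.J x, C.J ⁅C.J x, (y : 𝔤)⁆⁆ (C.J y) -
        g.inner ⁅C.J x, (y : 𝔤)⁆ ⁅C.J x, (y : 𝔤)⁆) +
      (g.inner ⁅C.J x, C.J ⁅C.J x, C.J y⁆⁆ y - g.inner ⁅C.J x, C.J y⁆ ⁅C.J x, C.J y⁆) = 0
    linarith
  have hsum : ∑ i, Q (J * A) i + ∑ i, Q (A * J) i + ∑ i, Q (J * B) i + ∑ i, Q (B * J) i = 0 := by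
    simp only [← Finset.sum_add_distrib, hpt, Finset.sum_const_zero]
  have hle : ∀ T : Module.End ℝ h, ∑ i, Q T i ≤ 0 := sum_sq_sub_norm_nonpos gh.symm he
  refine symmetric_of_sum_sq_sub_norm_nonneg gh.symm he (J * A) ?_ ⟨a, ha⟩ ⟨b, hb⟩
  change 0 ≤ ∑ i, Q (J * A) i
  linarith [hle (A * J), hle (J * B), hle (B * J)]

/-! ### Splitting off the ideal, and the Kähler metric -/

/-- A balanced metric on a unimodular Lie algebra, for which the orthogonal complement of a
`J`-invariant ideal is abelian, restricts to a metric on the ideal whose bivector `∑ eᵢ ∧ J eᵢ` is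
again killed by the bracket. -/
theorem exists_basis_sum_lie_eq_zero [FiniteDimensional ℝ 𝔤] (hunim : IsUnimodular 𝔤)
    (g : HermitianMetric C) (hbal : g.IsBalanced) (h : LieIdeal ℝ 𝔤) (hJ : ∀ x ∈ h, C.J x ∈ h)
    (hperp : ∀ x ∈ g.inner.orthogonal h.toSubmodule,
      ∀ y ∈ g.inner.orthogonal h.toSubmodule, ⁅x, y⁆ = 0) :
    ∃ e : Module.Basis (Fin (Module.finrank ℝ h)) ℝ h,
      ∑ i, ⁅e i, (C.restrict h hJ).J (e i)⁆ = 0 := by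
  let V := g.inner.orthogonal h.toSubmodule
  have hVJ : ∀ v ∈ V, C.J v ∈ V := fun v hv n hn => by
    rw [g.symm, g.inner_J_left, g.symm, hv _ (hJ n hn), neg_zero]
  have hrefl : g.inner.IsRefl := fun x y h => by rw [g.symm]; exact h
  have hcompl : IsCompl h.toSubmodule V := by
    rw [LinearMap.BilinForm.isCompl_orthogonal_iff_disjoint hrefl, Submodule.disjoint_def]
    intro x hx hx'
    exact g.eq_zero_of_inner_self_nonpos (hx' x hx).le
  obtain ⟨e, he⟩ := exists_orthonormal_basis (g.restrict h hJ).inner (g.restrict h hJ).symm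
    (g.restrict h hJ).pos
  obtain ⟨f, hf⟩ := exists_orthonormal_basis (g.inner.restrict V) (fun x y => g.symm x y)
    (fun x hx => g.pos x fun h0 => hx (Subtype.ext h0))
  let b := (Module.Basis.prod e f).map (Submodule.prodEquivOfIsCompl _ _ hcompl)
  have hbl : ∀ i, b (Sum.inl i) = (e i : 𝔤) := fun i => by
    rw [Module.Basis.map_apply, Submodule.coe_prodEquivOfIsCompl']
    simp
  have hbr : ∀ i, b (Sum.inr i) = (f i : 𝔤) := fun i => by
    rw [Module.Basis.map_apply, Submodule.coe_prodEquivOfIsCompl']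
    simp
  have hb : ∀ i j, g.inner (b i) (b j) = if i = j then 1 else 0 := by
    rintro (i | i) (j | j)
    · rw [hbl, hbl]; simpa only [Sum.inl.injEq] using! he i j
    · rw [hbl, hbr]; simpa using (f j).2 _ (e i).2
    · rw [hbl, hbr, g.symm]; simpa using (f i).2 _ (e j).2
    · rw [hbr, hbr]; simpa only [Sum.inr.injEq] using! hf i j
  have hsum := g.sum_lie_eq_zero_of_isBalanced hunim hbal b hb
  rw [Fintype.sum_sum_type] at hsum
  simp only [hbl, hbr] at hsum
  rw [Finset.sum_eq_zero (s := Finset.univ) (f := fun i => ⁅(f i : 𝔤), C.J (f i : 𝔤)⁆)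
    fun i _ => hperp _ (f i).2 _ (hVJ _ (f i).2), add_zero] at hsum
  refine ⟨e, Subtype.ext ?_⟩
  change h.toSubmodule.subtype (∑ i, ⁅e i, (C.restrict h hJ).J (e i)⁆) = 0
  rw [map_sum]
  exact hsum

/-- For a projection `P` commuting with `J`: the metric that is `g₁` on the kernel of `P`, is `g₂` on
its image, and makes these two `J`-invariant subspaces orthogonal. -/
def glue (g₁ g₂ : HermitianMetric C) (P : 𝔤 →ₗ[ℝ] 𝔤) (hPJ : ∀ x, P (C.J x) = C.J (P x)) :
    HermitianMetric C where
  inner := g₁.inner.compl₁₂ (LinearMap.id - P) (LinearMap.id - P) + g₂.inner.compl₁₂ P P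
  symm x y := by
    simp only [LinearMap.add_apply, LinearMap.compl₁₂_apply]
    rw [g₁.symm, g₂.symm]
  pos x hx := by
    simp only [LinearMap.add_apply, LinearMap.compl₁₂_apply]
    by_cases h : P x = 0
    · have := g₁.pos x hx
      simpa [h] using this
    · exact add_pos_of_nonneg_of_pos (g₁.inner_self_nonneg _) (g₂.pos _ h)
  invariant x y := by
    simp only [LinearMap.add_apply, LinearMap.compl₁₂_apply, LinearMap.sub_apply,
      LinearMap.id_apply, hPJ, ← map_sub C.J, g₁.invariant, g₂.invariant]

/-- Gluing along a splitting into an abelian ideal `W` and an abelian complement gives a Kähler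
metric as soon as the operators `J ∘ ad x` are `g₁`-symmetric on the ideal. -/
theorem isKahler_glue (g₁ g₂ : HermitianMetric C) (P : 𝔤 →ₗ[ℝ] 𝔤)
    (hPJ : ∀ x, P (C.J x) = C.J (P x)) {W : LieIdeal ℝ 𝔤} (hPsub : ∀ x, x - P x ∈ W)
    (hPW : ∀ w ∈ W, P w = 0) (hab : ∀ a ∈ W, ∀ b ∈ W, ⁅a, b⁆ = 0)
    (hP : ∀ x y : 𝔤, ⁅P x, P y⁆ = 0)
    (hsymm : ∀ x : 𝔤, ∀ a ∈ W, ∀ b ∈ W, g₁.inner (C.J ⁅x, a⁆) b = g₁.inner (C.J ⁅x, b⁆) a) :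
    (glue g₁ g₂ P hPJ).IsKahler := by
  have hlie : ∀ x y : 𝔤, ⁅x, y⁆ = ⁅P x, y - P y⁆ - ⁅P y, x - P x⁆ := fun x y => by
    have h1 := hab _ (hPsub x) _ (hPsub y)
    rw [← lie_skew (P y), sub_neg_eq_add]
    rw [sub_lie, sub_eq_zero, lie_sub x, sub_eq_iff_eq_add] at h1
    rw [h1, sub_lie, hP, sub_zero]
  have hform : ∀ x y z : 𝔤, (glue g₁ g₂ P hPJ).fundamentalForm ⁅x, y⁆ z =
      g₁.inner (C.J ⁅P x, y - P y⁆) (z - P z) - g₁.inner (C.J ⁅P y, x - P x⁆) (z - P z) := by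
    intro x y z
    have hmem : P ⁅x, y⁆ = 0 := hPW _ <| by
      rw [hlie]
      exact sub_mem (lie_mem_right ℝ 𝔤 W _ _ (hPsub y)) (lie_mem_right ℝ 𝔤 W _ _ (hPsub x))
    simp only [fundamentalForm, glue, LinearMap.add_apply, LinearMap.compl₁₂_apply,
      LinearMap.sub_apply, LinearMap.id_apply, hPJ, hmem, map_zero, LinearMap.zero_apply,
      sub_zero, add_zero]
    rw [← LinearMap.sub_apply, ← map_sub, ← map_sub, ← hlie]
  intro x y z
  rw [d₂, hform, hform, hform]
  linarith [hsymm (P x) _ (hPsub y) _ (hPsub z), hsymm (P y) _ (hPsub x) _ (hPsub z),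
    hsymm (P z) _ (hPsub x) _ (hPsub y)]

end HermitianMetric

end HermitianLie

theorem corollary2p4 {𝔤 : Type*} [LieRing 𝔤] [LieAlgebra ℝ 𝔤] [FiniteDimensional ℝ 𝔤]
    (hsolv : LieAlgebra.IsSolvable 𝔤) (hunim : HermitianLie.IsUnimodular 𝔤)
    (h : LieIdeal ℝ 𝔤) (hnil : HermitianLie.IsNilradical h)
    (hcodim : Module.finrank ℝ 𝔤 = Module.finrank ℝ h + 2)
    (C : HermitianLie.ComplexStructure 𝔤)
    (hJ : Submodule.map C.J h.toSubmodule = h.toSubmodule)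
    (g₁ g₂ : HermitianLie.HermitianMetric C)
    (hskt : g₁.IsSKT) (hbal : g₂.IsBalanced)
    (hperp : ∀ x ∈ g₂.inner.orthogonal h.toSubmodule,
      ∀ y ∈ g₂.inner.orthogonal h.toSubmodule, ⁅x, y⁆ = 0) :
    ∃ g : HermitianLie.HermitianMetric C, g.IsKahler := by
  have hJh : ∀ x ∈ h, C.J x ∈ h := fun x hx => by
    have : C.J x ∈ Submodule.map C.J h.toSubmodule := Submodule.mem_map_of_mem hx
    rwa [hJ] at this
  have : LieRing.IsNilpotent h := hnil.1
  obtain ⟨e, he⟩ := g₂.exists_basis_sum_lie_eq_zero hunim hbal h hJh hperp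
  have hab : ∀ a ∈ h, ∀ b ∈ h, ⁅a, b⁆ = 0 := fun a ha b hb =>
    congrArg Subtype.val ((g₁.restrict h hJh).lie_eq_zero_of_isSKT_of_sum_lie_eq_zero
      (HermitianLie.HermitianMetric.isSKT_restrict hskt h hJh) e he ⟨a, ha⟩ ⟨b, hb⟩)
  obtain ⟨P, hPsub, hPperp, hPW, hPJ⟩ := g₂.exists_projection h.toSubmodule hJh
  have hPP : ∀ x y : 𝔤, ⁅P x, P y⁆ = 0 := fun x y =>
    hperp _ (fun w hw => by rw [g₂.symm]; exact hPperp x w hw) _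
      (fun w hw => by rw [g₂.symm]; exact hPperp y w hw)
  have hder : ∀ x y : 𝔤, ⁅x, y⁆ ∈ h := fun x y => by
    have h1 : ⁅x, y⁆ = ⁅x - P x, y⁆ + ⁅P x, y - P y⁆ := by
      rw [sub_lie, lie_sub, hPP]; abel
    rw [h1]
    exact add_mem (lie_mem_left ℝ 𝔤 h _ _ (hPsub x)) (lie_mem_right ℝ 𝔤 h _ _ (hPsub y))
  exact ⟨g₁.glue g₂ P hPJ, g₁.isKahler_glue g₂ P hPJ hPsub hPW hab hPP fun x a ha b hb =>
    g₁.inner_J_lie_symm_of_isSKT hskt h hJh hab hder x ha hb⟩
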